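/- Let $G$ be a locally compact (Hausdorff), $\sigma$-compact, amenable group which is unimodular, i.e. its left Haar measure $m$ is also right-invariant, and let $G$ act continuously (that is, $(g,x)\mapsto gx$ is continuous on $G\times X$) and minimally (every orbit is dense) on a compact metric space $(X,d)$. A left Følner sequence is a sequence $\mathcal F=(F_n)_{n\in\mathbb N}$ of compact subsets of $G$ with $m(F_n)>0$ and $\lim_{n\to\infty} m(KF_n\triangle F_n)/m(F_n)=0$ for every nonempty compact $K\subseteq G$. For such $\mathcal F$ and $x,y\in X$ put \[ D_{\mathcal F}(x,y)=\limsup_{n\to\infty}\frac1{m(F_n)}\int_{F_n}d(tx,ty)\,dm(t),\qquad D(x,y)=\sup\{D_{\mathcal F}(x,y) : \mathcal F \text{ is a left Følner sequence}\}. \] The system $(X,G)$ is (Weyl) mean equicontinuous if $D$ is continuous on $X\times X$. For $\delta>0$ and $\nu\in(0,1]$, a set $S\subseteq X$ is $(\delta,\nu)$-separated with respect to $\mathcal F$ if \[ \limsup_{n\to\infty}\frac{m(\{t\in F_n : d(tx,ty)\ge\delta\})}{m(F_n)}\ge\nu \] for all distinct $x,y\in S$; the separation number $\mathrm{Sep}_{\mathcal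 F}(X,G,\delta,\nu)$ is the supremum of the cardinalities of all $(\delta,\nu)$-separated subsets of $X$, and $(X,G)$ has finite separation numbers with respect to $\mathcal F$ if $\mathrm{Sep}_{\mathcal F}(X,G,\delta,\nu)<\infty$ for all $\delta>0$ and all $\nu\in(0,1]$. Then $(X,G)$ is (Weyl) mean equicontinuous if and only if it has finite separation numbers with respect to every left Følner sequence in $G$. -/

import Mathlib

open MeasureTheory Filter Topology Set
open scoped Pointwise ENNReal BoundedContinuousFunction symmDiff

noncomputable section

namespace SepNum

/-- Amenability of a topological group: there is a left-invariant mean on the bounded continuous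
real-valued functions. -/
def IsAmenable (G : Type*) [Group G] [TopologicalSpace G] [IsTopologicalGroup G] : Prop :=
  ∃ Λ : (G →ᵇ ℝ) →ₗ[ℝ] ℝ,
    Λ (BoundedContinuousFunction.const G 1) = 1 ∧
    (∀ f : G →ᵇ ℝ, (∀ t, 0 ≤ f t) → 0 ≤ Λ f) ∧
    ∀ (g : G) (f : G →ᵇ ℝ),
      Λ (f.compContinuous ⟨fun t => g * t, continuous_const_mul g⟩) = Λ f

/-- Left Følner sequences, with respect to the left Haar measure `m`: compact sets `F n` of positive
measure with `m (K F_n ∆ F_n) / m (F_n) → 0` for every (nonempty) compact set `K`. For `K = ∅` the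
quotient is constantly `1`, so the empty set has to be excluded. -/
structure IsLeftFolner {G : Type*} [Group G] [TopologicalSpace G] [MeasurableSpace G]
    (m : Measure G) (F : ℕ → Set G) : Prop where
  isCompact : ∀ n, IsCompact (F n)
  measure_pos : ∀ n, 0 < m (F n)
  tendsto : ∀ K : Set G, IsCompact K → K.Nonempty →
    Tendsto (fun n => m ((K * F n) ∆ (F n)) / m (F n)) atTop (𝓝 0)

/-- The upper asymptotic density of `E ⊆ G` with respect to `F`. -/
def upperDensity {G : Type*} [MeasurableSpace G] (m : Measure G) (F : ℕ → Set G)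
    (E : Set G) : ℝ≥0∞ :=
  limsup (fun n => m (E ∩ F n) / m (F n)) atTop

/-- The set of all `t ∈ G` with `d (t x, t y) ≥ δ`. -/
def sepTimes (G : Type*) {X : Type*} [Group G] [MetricSpace X] [MulAction G X]
    (δ : ℝ) (x y : X) : Set G :=
  {t : G | δ ≤ dist (t • x) (t • y)}

/-- `S ⊆ X` is `(δ, ν)`-separated with respect to `F`. -/
def IsSeparatedSet {G X : Type*} [Group G] [MeasurableSpace G] [MetricSpace X] [MulAction G X]
    (m : Measure G) (F : ℕ → Set G) (δ ν : ℝ) (S : Set X) : Prop :=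
  ∀ x ∈ S, ∀ y ∈ S, x ≠ y → ENNReal.ofReal ν ≤ upperDensity m F (sepTimes G δ x y)

/-- The asymptotic separation number: the supremum of the cardinalities of the
`(δ, ν)`-separated subsets of `X`. -/
def sepNumber {G : Type*} (X : Type*) [Group G] [MeasurableSpace G] [MetricSpace X]
    [MulAction G X] (m : Measure G) (F : ℕ → Set G) (δ ν : ℝ) : ℕ∞ :=
  ⨆ (S : Set X) (_ : IsSeparatedSet m F δ ν S), S.encard

/-- `(X, G)` has finite separation numbers with respect to `F`. -/
def HasFiniteSepNumbers {G : Type*} (X : Type*) [Group G] [MeasurableSpace G] [MetricSpace X]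
    [MulAction G X] (m : Measure G) (F : ℕ → Set G) : Prop :=
  ∀ δ : ℝ, 0 < δ → ∀ ν ∈ Ioc (0 : ℝ) 1, sepNumber X m F δ ν < ⊤

/-- The Besicovitch pseudometric `D_F (x, y) = limsup_n m(F_n)⁻¹ ∫_{F_n} d (t x, t y) dm(t)`. -/
def besicovitchDist {G X : Type*} [Group G] [MeasurableSpace G] [MetricSpace X] [MulAction G X]
    (m : Measure G) (F : ℕ → Set G) (x y : X) : ℝ≥0∞ :=
  limsup (fun n => (∫⁻ t in F n, edist (t • x) (t • y) ∂m) / m (F n)) atTop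

/-- The Weyl pseudometric `D`: the supremum of `D_F (x, y)` over all left Følner sequences `F`. -/
def weylDist {G X : Type*} [Group G] [TopologicalSpace G] [MeasurableSpace G] [MetricSpace X]
    [MulAction G X] (m : Measure G) (x y : X) : ℝ≥0∞ :=
  ⨆ (F : ℕ → Set G) (_ : IsLeftFolner m F), besicovitchDist m F x y

/-- `(X, G)` is (Weyl) mean equicontinuous: the pseudometric `D` is continuous on `X × X`. -/
def IsMeanEquicontinuous {G : Type*} (X : Type*) [Group G] [TopologicalSpace G]
    [MeasurableSpace G] [MetricSpace X] [MulAction G X] (m : Measure G) : Prop :=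
  Continuous fun p : X × X => weylDist m p.1 p.2

end SepNum

end

/-!
Both implications compare the Weyl pseudometric `D` with the topology of `X`.

If `D` is continuous, then `X` is covered by finitely many open sets of small `D`-diameter. By
Markov's inequality two points of one such set are never `(δ, ν)`-separated, so the number of these
sets bounds the separation number (`IsMeanEquicontinuous.hasFiniteSepNumbers`).

Conversely, suppose that all separation numbers are finite.

* `D` is totally bounded (`exists_finset_weylDist_lt`). Otherwise there is an infinite set whose
  distinct points have `D`-distance at least some `c > 0`. Each of its countably many pairs
  comes with a Følner sequence, and interleaving these gives a single Følner sequence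
  (`exists_isLeftFolner_frequently`) that separates all pairs at once.
* Since `G` is exhausted by compact sets `L j`, the inequality `D (s, y) < c` forces, for some `j`,
  that the average of `d (t s, t y)` over every `(L j, 1 / (j + 1))`-invariant compact set
  is at most `c`; this in turn forces `D (s, y) ≤ c`. The intermediate condition is closed in `y`,
  so the Baire category theorem yields a nonempty open set of small `D`-diameter
  (`exists_isOpen_weylDist_le`).
* Unimodularity makes `D` invariant under `G` (`weylDist_smul`), and by minimality the translates of
  that open set cover `X`. Hence `D` is small near the diagonal, and the triangle inequality makes
  it continuous.
-/

namespace SepNum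

section

variable {G X : Type*} [Group G] [TopologicalSpace G] [IsTopologicalGroup G] [T2Space G]
  [MeasurableSpace G] [BorelSpace G] {m : Measure G}
  [MetricSpace X] [MulAction G X] [ContinuousSMul G X]

/-! ### Averages of the distance along an orbit -/

/-- The average of `d (t x, t y)` over `t ∈ F`. -/
noncomputable def avgDist (m : Measure G) (F : Set G) (x y : X) : ℝ≥0∞ :=
  (∫⁻ t in F, edist (t • x) (t • y) ∂m) / m F

omit [IsTopologicalGroup G] [T2Space G] in
lemma measurable_edist_smul (x y : X) : Measurable fun t : G => edist (t • x) (t • y) := by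
  have h : Continuous fun t : G => edist (t • x) (t • y) := by fun_prop
  exact h.measurable

omit [IsTopologicalGroup G] [T2Space G] in
lemma measurableSet_sepTimes (δ : ℝ) (x y : X) : MeasurableSet (sepTimes G δ x y) := by
  have h : IsClosed (sepTimes G δ x y) :=
    isClosed_le continuous_const (by fun_prop : Continuous fun t : G => dist (t • x) (t • y))
  exact h.measurableSet

lemma edist_le_ofReal_diam [CompactSpace X] (x y : X) :
    edist x y ≤ ENNReal.ofReal (Metric.diam (univ : Set X)) := by
  rw [edist_dist]
  exact ENNReal.ofReal_le_ofReal
    (Metric.dist_le_diam_of_mem isCompact_univ.isBounded (mem_univ x) (mem_univ y))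

omit [IsTopologicalGroup G] [T2Space G] in
lemma continuous_avgDist_right [CompactSpace X] {F : Set G} (h0 : m F ≠ 0) (htop : m F ≠ ⊤)
    (x : X) : Continuous fun y => avgDist m F x y := by
  refine ENNReal.continuous_div_const _ h0 |>.comp (continuous_iff_continuousAt.2 fun y => ?_)
  refine tendsto_lintegral_filter_of_dominated_convergence
    (fun _ => ENNReal.ofReal (Metric.diam (univ : Set X)))
    (Eventually.of_forall fun z => measurable_edist_smul x z)
    (Eventually.of_forall fun z => ae_of_all _ fun t => edist_le_ofReal_diam _ _) ?_
    (ae_of_all _ fun t => ?_)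
  · rw [setLIntegral_const]
    exact ENNReal.mul_ne_top ENNReal.ofReal_ne_top htop
  · have h : Continuous fun z : X => edist (t • x) (t • z) := by fun_prop
    exact h.tendsto y

omit [IsTopologicalGroup G] [T2Space G] in
/-- Markov's inequality for the average distance. -/
lemma ofReal_mul_sepTimes_le_avgDist (F : Set G) (δ : ℝ) (x y : X) :
    ENNReal.ofReal δ * (m (sepTimes G δ x y ∩ F) / m F) ≤ avgDist m F x y := by
  rw [← mul_div_assoc]
  refine ENNReal.div_le_div_right ?_ _
  have h := mul_meas_ge_le_lintegral (μ := m.restrict F)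
    (measurable_edist_smul (G := G) x y) (ENNReal.ofReal δ)
  refine le_trans (le_of_eq ?_) h
  rw [← Measure.restrict_apply (measurableSet_sepTimes δ x y)]
  congr 2
  ext t
  simp [sepTimes, edist_dist, ENNReal.ofReal_le_ofReal_iff dist_nonneg]

omit [IsTopologicalGroup G] [T2Space G] in
lemma avgDist_le_add_mul_sepTimes [CompactSpace X] {F : Set G} (h0 : m F ≠ 0) (htop : m F ≠ ⊤)
    (δ : ℝ) (x y : X) :
    avgDist m F x y ≤ ENNReal.ofReal δ +
      ENNReal.ofReal (Metric.diam (univ : Set X)) * (m (sepTimes G δ x y ∩ F) / m F) := by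
  set B := ENNReal.ofReal (Metric.diam (univ : Set X))
  have key : ∫⁻ t in F, edist (t • x) (t • y) ∂m ≤
      ENNReal.ofReal δ * m F + B * m (sepTimes G δ x y ∩ F) := by
    calc ∫⁻ t in F, edist (t • x) (t • y) ∂m
        ≤ ∫⁻ t in F, (ENNReal.ofReal δ + (sepTimes G δ x y).indicator (fun _ => B) t) ∂m := by
          refine lintegral_mono fun t => ?_
          by_cases ht : t ∈ sepTimes G δ x y
          · rw [indicator_of_mem ht]
            exact (edist_le_ofReal_diam _ _).trans le_add_self
          · rw [indicator_of_notMem ht, add_zero]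
            rw [edist_dist]
            exact ENNReal.ofReal_le_ofReal (not_le.1 ht).le
      _ = ENNReal.ofReal δ * m F + B * m (sepTimes G δ x y ∩ F) := by
          rw [lintegral_add_left measurable_const, setLIntegral_const,
            lintegral_indicator_const (measurableSet_sepTimes δ x y),
            Measure.restrict_apply (measurableSet_sepTimes δ x y)]
  calc avgDist m F x y ≤ (ENNReal.ofReal δ * m F + B * m (sepTimes G δ x y ∩ F)) / m F :=
        ENNReal.div_le_div_right key _
    _ = _ := by
        rw [ENNReal.add_div, mul_div_assoc, mul_div_assoc, ENNReal.div_self h0 htop, mul_one]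

omit [IsTopologicalGroup G] [T2Space G] in
/-- A large average distance forces a definite proportion of separation times. -/
lemma ofReal_le_sepTimes_of_lt_avgDist [CompactSpace X] {F : Set G} (h0 : m F ≠ 0)
    (htop : m F ≠ ⊤) {c : ℝ} (hc : 0 < c) {x y : X} (h : ENNReal.ofReal c < avgDist m F x y) :
    ENNReal.ofReal (c / 2 / (Metric.diam (univ : Set X) + c)) ≤
      m (sepTimes G (c / 2) x y ∩ F) / m F := by
  set d := Metric.diam (univ : Set X)
  have hd : 0 ≤ d := Metric.diam_nonneg
  set r := m (sepTimes G (c / 2) x y ∩ F) / m F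
  have h1 : ENNReal.ofReal c ≤ ENNReal.ofReal (c / 2) + ENNReal.ofReal d * r :=
    h.le.trans (avgDist_le_add_mul_sepTimes h0 htop _ x y)
  have h2 : ENNReal.ofReal (c / 2) ≤ ENNReal.ofReal d * r := by
    rw [← add_halves c, ENNReal.ofReal_add (by positivity) (by positivity), add_halves] at h1
    exact (ENNReal.add_le_add_iff_left ENNReal.ofReal_ne_top).1 h1
  rw [ENNReal.ofReal_div_of_pos (by positivity)]
  refine ENNReal.div_le_of_le_mul' (h2.trans ?_)
  gcongr
  linarith

/-! ### Almost invariant sets and Følner sequences -/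

/-- A compact set `F` of positive measure is `(K, ε)`-invariant if the part of `K F` outside `F` has
at most the proportion `ε` of the measure of `F`. This one-sided condition is monotone in `K`. -/
structure IsAlmostInvariant (m : Measure G) (K : Set G) (ε : ℝ≥0∞) (F : Set G) : Prop where
  isCompact : IsCompact F
  measure_pos : 0 < m F
  measure_sdiff_le : m ((K * F) \ F) ≤ ε * m F

omit [IsTopologicalGroup G] [T2Space G] [BorelSpace G] in
lemma IsLeftFolner.eventually_isAlmostInvariant [IsFiniteMeasureOnCompacts m] {F : ℕ → Set G}
    (hF : IsLeftFolner m F) {K : Set G} (hK : IsCompact K) {ε : ℝ≥0∞} (hε : 0 < ε) :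
    ∀ᶠ n in atTop, IsAlmostInvariant m K ε (F n) := by
  rcases K.eq_empty_or_nonempty with rfl | hne
  · exact Eventually.of_forall fun n => ⟨hF.isCompact n, hF.measure_pos n, by simp⟩
  · filter_upwards [(hF.tendsto K hK hne).eventually_lt_const hε] with n hn
    refine ⟨hF.isCompact n, hF.measure_pos n, ?_⟩
    have hsub : (K * F n) \ F n ⊆ (K * F n) ∆ F n := subset_union_left
    refine (measure_mono hsub).trans ?_
    exact (ENNReal.div_le_iff (hF.measure_pos n).ne' (hF.isCompact n).measure_lt_top.ne).1 hn.le

/-- The one-sided invariance implies the two-sided one: `F \ K F` is contained in `F \ k F` for any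
`k ∈ K`, and this has the same measure as `k F \ F`. -/
lemma IsAlmostInvariant.measure_symmDiff_div_le [m.IsMulLeftInvariant]
    [IsFiniteMeasureOnCompacts m] {K L F : Set G} {ε : ℝ≥0∞} (hF : IsAlmostInvariant m L ε F)
    (hKL : K ⊆ L) (hne : K.Nonempty) : m ((K * F) ∆ F) / m F ≤ 2 * ε := by
  obtain ⟨k, hk⟩ := hne
  have hfin : m F ≠ ⊤ := hF.isCompact.measure_lt_top.ne
  have hmeas : MeasurableSet F := hF.isCompact.measurableSet
  have hkF : MeasurableSet (k • F) := (hF.isCompact.smul k).measurableSet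
  have hkK : k • F ⊆ K * F := smul_set_subset_mul hk
  have h1 : m ((K * F) \ F) ≤ ε * m F :=
    (measure_mono (sdiff_subset_sdiff_left (mul_subset_mul_right hKL))).trans hF.measure_sdiff_le
  have h2 : m (F \ (K * F)) ≤ ε * m F := by
    calc m (F \ (K * F)) ≤ m (F \ (k • F)) := measure_mono (sdiff_subset_sdiff_right hkK)
      _ = m ((k • F) \ F) := by
          refine measure_sdiff_symm hmeas.nullMeasurableSet hkF.nullMeasurableSet
            (measure_smul m k F).symm ?_
          exact ne_top_of_le_ne_top hfin (measure_mono inter_subset_left)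
      _ ≤ m ((K * F) \ F) := measure_mono (sdiff_subset_sdiff_left hkK)
      _ ≤ ε * m F := h1
  rw [ENNReal.div_le_iff hF.measure_pos.ne' hfin]
  calc m ((K * F) ∆ F) ≤ m ((K * F) \ F) + m (F \ (K * F)) := measure_union_le _ _
    _ ≤ ε * m F + ε * m F := add_le_add h1 h2
    _ = 2 * ε * m F := by ring

lemma isLeftFolner_of_isAlmostInvariant [m.IsMulLeftInvariant] [IsFiniteMeasureOnCompacts m]
    (L : CompactExhaustion G) {F : ℕ → Set G}
    (hF : ∀ j : ℕ, IsAlmostInvariant m (L j) ((j : ℝ≥0∞) + 1)⁻¹ (F j)) : IsLeftFolner m F where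
  isCompact j := (hF j).isCompact
  measure_pos j := (hF j).measure_pos
  tendsto K hK hne := by
    obtain ⟨n, hn⟩ := L.exists_superset_of_isCompact hK
    have hlim : Tendsto (fun j : ℕ => 2 * ((j : ℝ≥0∞) + 1)⁻¹) atTop (𝓝 0) := by
      have h := (tendsto_add_atTop_iff_nat 1).2 ENNReal.tendsto_inv_nat_nhds_zero
      simpa using ENNReal.Tendsto.const_mul (a := 2) h (Or.inr (by simp))
    refine tendsto_of_tendsto_of_tendsto_of_le_of_le' tendsto_const_nhds hlim
      (Eventually.of_forall fun _ => zero_le) ?_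
    filter_upwards [eventually_ge_atTop n] with j hj
    exact (hF j).measure_symmDiff_div_le (hn.trans (L.subset hj)) hne

omit [T2Space G] in
/-- Right translates of left Følner sequences are left Følner if the measure is right-invariant. -/
lemma IsLeftFolner.preimage_mul_right [m.IsMulRightInvariant] {F : ℕ → Set G}
    (hF : IsLeftFolner m F) (g : G) : IsLeftFolner m fun n => (fun t => t * g) ⁻¹' F n where
  isCompact n := (Homeomorph.mulRight g).isCompact_preimage.2 (hF.isCompact n)
  measure_pos n := by
    rw [measure_preimage_mul_right]
    exact hF.measure_pos n
  tendsto K hK hne := by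
    refine (hF.tendsto K hK hne).congr fun n => ?_
    have h : K * ((fun t => t * g) ⁻¹' F n) = (fun t => t * g) ⁻¹' (K * F n) := by
      ext t
      simp only [Set.mem_mul, mem_preimage]
      constructor
      · rintro ⟨k, hk, s, hs, rfl⟩
        exact ⟨k, hk, s * g, hs, (mul_assoc _ _ _).symm⟩
      · rintro ⟨k, hk, s, hs, hst⟩
        exact ⟨k, hk, s * g⁻¹, by simpa using hs, by
          rw [← mul_assoc, mul_inv_eq_iff_eq_mul]
          exact hst⟩
    rw [h, ← preimage_symmDiff, measure_preimage_mul_right, measure_preimage_mul_right]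

/-! ### The Weyl pseudometric -/

/-- Subadditivity of the upper limit in `ℝ≥0∞` along an arbitrary filter. Mathlib's versions require
an additive group or a filter closed under countable intersections. -/
lemma limsup_add_le_ennreal {ι : Type*} {l : Filter ι} (u v : ι → ℝ≥0∞) :
    limsup (fun n => u n + v n) l ≤ limsup u l + limsup v l := by
  refine ENNReal.le_of_forall_pos_le_add fun ε hε htop => ?_
  obtain ⟨hu, hv⟩ := ENNReal.add_lt_top.1 htop
  have hε2 : (ε / 2 : ℝ≥0∞) ≠ 0 := (ENNReal.half_pos (by simpa using hε.ne')).ne'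
  refine limsup_le_of_le (h := ?_)
  filter_upwards [eventually_lt_of_limsup_lt (ENNReal.lt_add_right hu.ne hε2),
    eventually_lt_of_limsup_lt (ENNReal.lt_add_right hv.ne hε2)] with n h1 h2
  refine (add_le_add h1.le h2.le).trans_eq ?_
  rw [add_add_add_comm, ENNReal.add_halves]

omit [TopologicalSpace G] [IsTopologicalGroup G] [T2Space G] [BorelSpace G]
  [ContinuousSMul G X] in
lemma besicovitchDist_eq (F : ℕ → Set G) (x y : X) :
    besicovitchDist m F x y = limsup (fun n => avgDist m (F n) x y) atTop :=
  rfl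

omit [IsTopologicalGroup G] [T2Space G] [BorelSpace G] [ContinuousSMul G X] in
lemma besicovitchDist_le_weylDist {F : ℕ → Set G} (hF : IsLeftFolner m F) (x y : X) :
    besicovitchDist m F x y ≤ weylDist m x y :=
  le_iSup₂_of_le F hF le_rfl

omit [IsTopologicalGroup G] [T2Space G] [BorelSpace G] [ContinuousSMul G X] in
lemma weylDist_self (x : X) : weylDist m x x = 0 := by
  simp [weylDist, besicovitchDist]

omit [IsTopologicalGroup G] [T2Space G] [BorelSpace G] [ContinuousSMul G X] in
lemma weylDist_comm (x y : X) : weylDist m x y = weylDist m y x := by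
  simp only [weylDist, besicovitchDist, edist_comm]

omit [IsTopologicalGroup G] [T2Space G] in
lemma weylDist_triangle (x y z : X) :
    weylDist m x z ≤ weylDist m x y + weylDist m y z := by
  refine iSup₂_le fun F hF => ?_
  refine le_trans ?_ (add_le_add (besicovitchDist_le_weylDist hF x y)
    (besicovitchDist_le_weylDist hF y z))
  simp only [besicovitchDist_eq]
  refine le_trans (limsup_le_limsup (Eventually.of_forall fun n => ?_))
    (limsup_add_le_ennreal (fun n => avgDist m (F n) x y) fun n => avgDist m (F n) y z)
  simp only [avgDist]
  rw [← ENNReal.add_div, ← lintegral_add_left (measurable_edist_smul x y)]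
  exact ENNReal.div_le_div_right (lintegral_mono fun t => edist_triangle _ _ _) _

omit [IsTopologicalGroup G] [T2Space G] [BorelSpace G] [ContinuousSMul G X] in
lemma weylDist_ne_top [CompactSpace X] [IsFiniteMeasureOnCompacts m] (x y : X) :
    weylDist m x y ≠ ⊤ := by
  refine ne_top_of_le_ne_top (ENNReal.ofReal_ne_top (r := Metric.diam (univ : Set X)))
    (iSup₂_le fun F hF => ?_)
  refine limsup_le_of_le (h := Eventually.of_forall fun n => ?_)
  rw [ENNReal.div_le_iff (hF.measure_pos n).ne' (hF.isCompact n).measure_lt_top.ne,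
    ← setLIntegral_const]
  exact lintegral_mono fun t => edist_le_ofReal_diam _ _

omit [T2Space G] [ContinuousSMul G X] in
lemma weylDist_le_weylDist_smul [m.IsMulRightInvariant] (g : G) (x y : X) :
    weylDist m x y ≤ weylDist m (g • x) (g • y) := by
  refine iSup₂_le fun F hF => ?_
  refine le_trans (le_of_eq ?_) (besicovitchDist_le_weylDist (hF.preimage_mul_right g) _ _)
  unfold besicovitchDist
  congr 1
  funext n
  rw [measure_preimage_mul_right, ← (measurePreserving_mul_right m g).setLIntegral_comp_preimage_emb
    (measurableEmbedding_mulRight g)]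
  simp only [mul_smul]

omit [T2Space G] [ContinuousSMul G X] in
lemma weylDist_smul [m.IsMulRightInvariant] (g : G) (x y : X) :
    weylDist m (g • x) (g • y) = weylDist m x y := by
  refine le_antisymm ?_ (weylDist_le_weylDist_smul g x y)
  simpa using weylDist_le_weylDist_smul (m := m) g⁻¹ (g • x) (g • y)

omit [IsTopologicalGroup G] [T2Space G] [BorelSpace G] [ContinuousSMul G X] in
lemma exists_isAlmostInvariant_lt_avgDist [IsFiniteMeasureOnCompacts m] {K : Set G}
    (hK : IsCompact K) {ε : ℝ≥0∞} (hε : 0 < ε) {c : ℝ≥0∞} {x y : X} (h : c < weylDist m x y) :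
    ∃ F, IsAlmostInvariant m K ε F ∧ c < avgDist m F x y := by
  simp only [weylDist, lt_iSup_iff] at h
  obtain ⟨F, hF, hc⟩ := h
  obtain ⟨n, hn, hn'⟩ := ((frequently_lt_of_lt_limsup (by isBoundedDefault) hc).and_eventually
    (hF.eventually_isAlmostInvariant hK hε)).exists
  exact ⟨F n, hn', hn⟩

omit [IsTopologicalGroup G] [T2Space G] [BorelSpace G] [ContinuousSMul G X] in
/-- A bound on almost invariant sets bounds the Weyl pseudometric, as every Følner sequence is
eventually `(K, ε)`-invariant. -/
lemma weylDist_le_of_isAlmostInvariant [IsFiniteMeasureOnCompacts m] {K : Set G}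
    (hK : IsCompact K) {ε : ℝ≥0∞} (hε : 0 < ε) {c : ℝ≥0∞} {x y : X}
    (h : ∀ F, IsAlmostInvariant m K ε F → avgDist m F x y ≤ c) : weylDist m x y ≤ c := by
  by_contra! hlt
  obtain ⟨F, hF, hc⟩ := exists_isAlmostInvariant_lt_avgDist hK hε hlt
  exact (h F hF).not_gt hc

omit [ContinuousSMul G X] in
/-- A bound on the Weyl pseudometric bounds all averages over sufficiently invariant sets: otherwise
the violating sets would form a Følner sequence. -/
lemma exists_forall_avgDist_le_of_weylDist_lt [m.IsMulLeftInvariant] [IsFiniteMeasureOnCompacts m]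
    (L : CompactExhaustion G) {c : ℝ≥0∞} {x y : X} (h : weylDist m x y < c) :
    ∃ j : ℕ, ∀ F, IsAlmostInvariant m (L j) ((j : ℝ≥0∞) + 1)⁻¹ F → avgDist m F x y ≤ c := by
  by_contra! hne
  choose F hF hc using hne
  refine h.not_ge (le_trans ?_
    (besicovitchDist_le_weylDist (isLeftFolner_of_isAlmostInvariant L hF) x y))
  exact le_limsup_of_frequently_le' (Frequently.of_forall fun j => (hc j).le)

omit [ContinuousSMul G X] in
/-- Countably many pairs at Weyl distance greater than `c` are seen by a common Følner sequence,
which interleaves the Følner sequences of the individual pairs. -/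
lemma exists_isLeftFolner_frequently [WeaklyLocallyCompactSpace G] [SigmaCompactSpace G]
    [m.IsMulLeftInvariant] [IsFiniteMeasureOnCompacts m] {ι : Type*} [Countable ι] [Nonempty ι]
    (x y : ι → X) {c : ℝ≥0∞} (h : ∀ i, c < weylDist m (x i) (y i)) :
    ∃ F, IsLeftFolner m F ∧ ∀ i, ∃ᶠ n in atTop, c < avgDist m (F n) (x i) (y i) := by
  obtain ⟨e, he⟩ := exists_surjective_nat ι
  let L := CompactExhaustion.choice G
  -- The sequence `n ↦ e n.unpair.1` visits every index infinitely often.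
  have key : ∀ n : ℕ, ∃ F, IsAlmostInvariant m (L n) ((n : ℝ≥0∞) + 1)⁻¹ F ∧
      c < avgDist m F (x (e n.unpair.1)) (y (e n.unpair.1)) := fun n =>
    exists_isAlmostInvariant_lt_avgDist (L.isCompact n)
      (ENNReal.inv_pos.2 (by finiteness)) (h _)
  choose F hF hc using key
  refine ⟨F, isLeftFolner_of_isAlmostInvariant L hF, fun i => ?_⟩
  obtain ⟨k, rfl⟩ := he i
  refine frequently_atTop.2 fun a => ⟨Nat.pair k a, Nat.right_le_pair k a, ?_⟩
  simpa using hc (Nat.pair k a)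

/-! ### Continuity of the Weyl pseudometric bounds the separation numbers -/

omit [IsTopologicalGroup G] [T2Space G] in
lemma upperDensity_sepTimes_lt {F : ℕ → Set G} {δ ν : ℝ} (hδ : 0 < δ) (hν : 0 < ν) {x y : X}
    (h : besicovitchDist m F x y < ENNReal.ofReal (δ * (ν / 2))) :
    upperDensity m F (sepTimes G δ x y) < ENNReal.ofReal ν := by
  refine lt_of_le_of_lt (b := ENNReal.ofReal (ν / 2)) ?_
    ((ENNReal.ofReal_lt_ofReal_iff hν).2 (by linarith))
  refine limsup_le_of_le (h := ?_)
  filter_upwards [eventually_lt_of_limsup_lt h] with n hn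
  have h1 := (ofReal_mul_sepTimes_le_avgDist (m := m) (F n) δ x y).trans hn.le
  rw [ENNReal.ofReal_mul hδ.le] at h1
  exact (ENNReal.mul_le_mul_iff_right (by simpa using hδ) ENNReal.ofReal_ne_top).1 h1

omit [IsTopologicalGroup G] [T2Space G] in
theorem IsMeanEquicontinuous.hasFiniteSepNumbers [CompactSpace X]
    (h : IsMeanEquicontinuous X m) {F : ℕ → Set G} (hF : IsLeftFolner m F) :
    HasFiniteSepNumbers X m F := by
  intro δ hδ ν hν
  set c := ENNReal.ofReal (δ * (ν / 2))
  have hc : 0 < c := ENNReal.ofReal_pos.2 (mul_pos hδ (half_pos hν.1))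
  have hU : ∀ x : X, ∃ U ∈ 𝓝 x, ∀ y ∈ U, ∀ z ∈ U, weylDist m y z < c := by
    intro x
    have hx : ∀ᶠ p in 𝓝 (x, x), weylDist m p.1 p.2 < c :=
      (h.tendsto (x, x)).eventually_lt_const (by simpa [weylDist_self] using hc)
    rw [nhds_prod_eq] at hx
    exact (eventually_prod_self_iff (r := fun y z => weylDist m y z < c)).1 hx
  choose U hU hUc using hU
  obtain ⟨t, -, ht⟩ := isCompact_univ.elim_nhds_subcover U fun x _ => hU x
  have hcov : ∀ x : X, ∃ i ∈ t, x ∈ U i := fun x => by simpa using ht (mem_univ x)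
  choose f hft hfU using hcov
  refine lt_of_le_of_lt (b := (t : Set X).encard) (iSup₂_le fun S hS => ?_) (by simp)
  refine encard_le_encard_of_injOn (f := f) (fun x _ => hft x) fun x hx y hy hxy => ?_
  by_contra hne
  refine (hS x hx y hy hne).not_gt (upperDensity_sepTimes_lt hδ hν.1 ?_)
  exact (besicovitchDist_le_weylDist hF x y).trans_lt
    (hUc (f x) x (hfU x) y (hxy ▸ hfU y))

/-! ### Finite separation numbers make the Weyl pseudometric continuous -/

/-- If all separation numbers are finite, then the Weyl pseudometric is totally bounded. -/
lemma exists_finset_weylDist_lt [WeaklyLocallyCompactSpace G] [SigmaCompactSpace G]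
    [m.IsMulLeftInvariant] [IsFiniteMeasureOnCompacts m] [CompactSpace X]
    (h : ∀ F : ℕ → Set G, IsLeftFolner m F → HasFiniteSepNumbers X m F) {c : ℝ} (hc : 0 < c) :
    ∃ t : Finset X, ∀ x, ∃ s ∈ t, weylDist m s x < ENNReal.ofReal c := by
  by_contra! hne
  have : Std.Symm fun x y : X => ENNReal.ofReal c ≤ weylDist m x y :=
    ⟨fun x y hxy => by rwa [weylDist_comm]⟩
  obtain ⟨f, -, hf⟩ := exists_seq_of_forall_finset_exists' (fun _ : X => True)
    (fun x y => ENNReal.ofReal c ≤ weylDist m x y)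
    (fun t _ => (hne t).imp fun x hx => ⟨trivial, hx⟩)
  have hinj : Function.Injective f := by
    intro i j hij
    by_contra hne
    have h1 := hf hne
    simp only [hij, Function.onFun, weylDist_self] at h1
    exact (ENNReal.ofReal_pos.2 hc).not_ge h1
  have hc2 : 0 < c / 2 := half_pos hc
  have : Nonempty {q : ℕ × ℕ // q.1 ≠ q.2} := ⟨⟨(0, 1), by simp⟩⟩
  obtain ⟨F, hF, hfreq⟩ := exists_isLeftFolner_frequently (m := m)
    (fun q : {q : ℕ × ℕ // q.1 ≠ q.2} => f q.1.1) (fun q => f q.1.2) (c := ENNReal.ofReal (c / 2))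
    (fun q => ((ENNReal.ofReal_lt_ofReal_iff hc).2 (half_lt_self hc)).trans_le (hf q.2))
  set ν := c / 2 / 2 / (Metric.diam (univ : Set X) + c / 2) with hνdef
  have hd : 0 ≤ Metric.diam (univ : Set X) := Metric.diam_nonneg
  have hν : ν ∈ Ioc (0 : ℝ) 1 :=
    ⟨by positivity, (div_le_one (by positivity)).2 (by linarith)⟩
  have hsep : IsSeparatedSet m F (c / 2 / 2) ν (range f) := by
    rintro _ ⟨i, rfl⟩ _ ⟨j, rfl⟩ hij
    refine le_limsup_of_frequently_le' ?_
    refine (hfreq ⟨(i, j), fun e => hij (congrArg f e)⟩).mono fun n hn => ?_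
    exact ofReal_le_sepTimes_of_lt_avgDist (hF.measure_pos n).ne'
      (hF.isCompact n).measure_lt_top.ne hc2 hn
  refine (h F hF (c / 2 / 2) (half_pos hc2) ν hν).not_ge ?_
  refine le_iSup₂_of_le (range f) hsep ?_
  rw [(infinite_range_of_injective hinj).encard_eq]

/-- The Baire category argument: the sets `C (s, j)` of points `y` whose average distance to `s` is
at most `c` over all `(L j, 1 / (j + 1))`-invariant sets are closed and cover `X`. -/
lemma exists_isOpen_weylDist_le [WeaklyLocallyCompactSpace G] [SigmaCompactSpace G]
    [m.IsMulLeftInvariant] [IsFiniteMeasureOnCompacts m] [CompactSpace X] [Nonempty X]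
    {c : ℝ≥0∞} {t : Finset X} (ht : ∀ x, ∃ s ∈ t, weylDist m s x < c) :
    ∃ U : Set X, IsOpen U ∧ U.Nonempty ∧ ∃ s, ∀ y ∈ U, weylDist m s y ≤ c := by
  let L := CompactExhaustion.choice G
  let C : t × ℕ → Set X := fun p =>
    {y | ∀ F, IsAlmostInvariant m (L p.2) ((p.2 : ℝ≥0∞) + 1)⁻¹ F → avgDist m F (p.1 : X) y ≤ c}
  have hclosed : ∀ p, IsClosed (C p) := fun p => by
    simp only [C, Set.ofPred_forall]
    exact isClosed_iInter fun F => isClosed_iInter fun hF => isClosed_le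
      (continuous_avgDist_right hF.measure_pos.ne' hF.isCompact.measure_lt_top.ne _)
      continuous_const
  have hcover : ⋃ p, C p = univ := by
    refine eq_univ_of_forall fun y => mem_iUnion.2 ?_
    obtain ⟨s, hs, hsy⟩ := ht y
    obtain ⟨j, hj⟩ := exists_forall_avgDist_le_of_weylDist_lt L hsy
    exact ⟨(⟨s, hs⟩, j), hj⟩
  obtain ⟨p, hp⟩ := nonempty_interior_of_iUnion_of_closed hclosed hcover
  refine ⟨interior (C p), isOpen_interior, hp, p.1, fun y hy => ?_⟩
  exact weylDist_le_of_isAlmostInvariant (L.isCompact p.2) (ENNReal.inv_pos.2 (by finiteness))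
    (interior_subset hy)

omit [IsTopologicalGroup G] [T2Space G] in
/-- By the triangle inequality it suffices that the Weyl pseudometric is small near the
diagonal. -/
lemma isMeanEquicontinuous_of_eventually [CompactSpace X] [IsFiniteMeasureOnCompacts m]
    (h : ∀ c : ℝ≥0∞, 0 < c → ∀ x : X, ∀ᶠ y in 𝓝 x, weylDist m x y ≤ c) :
    IsMeanEquicontinuous X m := by
  refine continuous_iff_continuousAt.2 fun ⟨x, y⟩ => ?_
  refine (ENNReal.tendsto_nhds (weylDist_ne_top x y)).2 fun ε hε => ?_
  have hε2 : 0 < ε / 2 := ENNReal.half_pos hε.ne'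
  rw [nhds_prod_eq]
  filter_upwards [(h _ hε2 x).prod_mk (h _ hε2 y)] with p ⟨h1, h2⟩
  constructor
  · rw [tsub_le_iff_right]
    calc weylDist m x y ≤ weylDist m x p.1 + (weylDist m p.1 p.2 + weylDist m p.2 y) :=
          (weylDist_triangle x p.1 y).trans (by gcongr; exact weylDist_triangle _ _ _)
      _ ≤ ε / 2 + (weylDist m p.1 p.2 + ε / 2) := by
          rw [weylDist_comm p.2 y]
          gcongr
      _ = weylDist m p.1 p.2 + ε := by
          rw [add_left_comm, ENNReal.add_halves]
  · calc weylDist m p.1 p.2 ≤ weylDist m p.1 x + (weylDist m x y + weylDist m y p.2) :=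
          (weylDist_triangle p.1 x p.2).trans (by gcongr; exact weylDist_triangle _ _ _)
      _ ≤ ε / 2 + (weylDist m x y + ε / 2) := by
          rw [weylDist_comm p.1 x]
          gcongr
      _ = weylDist m x y + ε := by
          rw [add_left_comm, ENNReal.add_halves]

theorem isMeanEquicontinuous_of_hasFiniteSepNumbers [WeaklyLocallyCompactSpace G]
    [SigmaCompactSpace G] [m.IsMulLeftInvariant] [m.IsMulRightInvariant]
    [IsFiniteMeasureOnCompacts m] [CompactSpace X] [MulAction.IsMinimal G X]
    (h : ∀ F : ℕ → Set G, IsLeftFolner m F → HasFiniteSepNumbers X m F) :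
    IsMeanEquicontinuous X m := by
  refine isMeanEquicontinuous_of_eventually fun c hc x => ?_
  have : Nonempty X := ⟨x⟩
  obtain ⟨r, hr0, hrc⟩ := ENNReal.lt_iff_exists_real_btwn.1 (ENNReal.half_pos hc.ne')
  obtain ⟨t, ht⟩ := exists_finset_weylDist_lt h (ENNReal.ofReal_pos.1 hrc.1)
  obtain ⟨U, hUo, hUne, s, hs⟩ := exists_isOpen_weylDist_le ht
  obtain ⟨g, hg⟩ := hUo.exists_smul_mem G x hUne
  have hev : ∀ᶠ y in 𝓝 x, g • y ∈ U := (continuous_const_smul g).continuousAt (hUo.mem_nhds hg)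
  filter_upwards [hev] with y hy
  rw [← weylDist_smul g]
  calc weylDist m (g • x) (g • y) ≤ weylDist m (g • x) s + weylDist m s (g • y) :=
        weylDist_triangle _ _ _
    _ ≤ c / 2 + c / 2 := by
        rw [weylDist_comm _ s]
        exact add_le_add ((hs _ hg).trans hrc.2.le) ((hs _ hy).trans hrc.2.le)
    _ = c := ENNReal.add_halves c

end

end SepNum

theorem mainTheorem3 {G X : Type*}
    [Group G] [TopologicalSpace G] [IsTopologicalGroup G] [T2Space G]
    [LocallyCompactSpace G] [SigmaCompactSpace G] [MeasurableSpace G] [BorelSpace G]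
    (hG : SepNum.IsAmenable G)
    (m : Measure G) [m.IsHaarMeasure] [m.Regular]
    (unimodular : m.IsMulRightInvariant)
    [MetricSpace X] [CompactSpace X] [MulAction G X] [ContinuousSMul G X]
    (minimal : MulAction.IsMinimal G X) :
    SepNum.IsMeanEquicontinuous X m ↔
      ∀ F : ℕ → Set G, SepNum.IsLeftFolner m F → SepNum.HasFiniteSepNumbers X m F :=
  ⟨fun h _ hF => h.hasFiniteSepNumbers hF,
    SepNum.isMeanEquicontinuous_of_hasFiniteSepNumbers⟩
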